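/- Let $K$ be a CM field (a totally imaginary quadratic extension of a totally real number field) such that $K/\mathbb{Q}$ is Galois with cyclic Galois group. Let $f$ be the least positive integer such that $K$ is isomorphic to a subfield of the cyclotomic field $\mathbb{Q}(\zeta_f)$. For a rational prime $p$, the decomposition type of $p$ in $K$ is the multiset of pairs $(e(\mathfrak{P}), f(\mathfrak{P}))$ of ramification index and inertia degree, where $\mathfrak{P}$ runs over the primes of $\mathcal{O}_K$ above $p$. Then the decomposition type of a prime $p$ unramified in $K$ depends only on the residue class of $p$ modulo $f$: if $p$ and $q$ are primes unramified in $K$ with $p \equiv q \pmod f$, then $p$ and $q$ have the same decomposition type in $K$. -/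

import Mathlib

open scoped NumberField

/-- The decomposition type of the rational prime `p` in the number field `K`: the multiset of pairs
`(e(P), f(P))` (ramification index and inertia degree), one for each prime `P` of `𝓞 K` over `p`. -/
noncomputable def decompositionType (K : Type*) [Field K] [NumberField K] (p : ℕ) :
    Multiset (ℕ × ℕ) :=
  (IsDedekindDomain.primesOverFinset (Ideal.span {(p : ℤ)}) (𝓞 K)).val.map
    fun P => (P.ramificationIdx ℤ, P.inertiaDeg ℤ)

/-- The positive integers `n` such that `K` is (isomorphic to) a subfield of `ℚ(ζ_n)`. -/
def cyclotomicLevels (K : Type*) [Field K] [NumberField K] : Set ℕ :=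
  {n | 0 < n ∧ Nonempty (K →ₐ[ℚ] CyclotomicField n ℚ)}

open Ideal MulAction IsCyclotomicExtension.Rat

open scoped Pointwise

/-! Embed `K` in `L = ℚ(ζ_f)`. For `p ∤ f`, the decomposition group of `p` in `Gal(L/ℚ) ≃ (ℤ/f)ˣ` is
generated by `p mod f`; intersecting it with `Gal(L/K)` shows that the inertia degree of `p` in `K`
depends only on `p mod f` (`inertiaDegIn_eq_of_modEq`). As `K/ℚ` is Galois, this degree fixes the
decomposition type of an unramified prime. -/

/-- The homomorphism `Gal(L/K) → (ℤ/nℤ)ˣ` giving the action on the `n`-th roots of unity, where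
`L = ℚ(ζₙ)` and `K` is a subfield of `L`. -/
noncomputable def relativeCyclotomicCharacter (n : ℕ) [NeZero n] (K L : Type*) [Field K]
    [Field L] [NumberField K] [NumberField L] [Algebra K L] [IsCyclotomicExtension {n} ℚ L] :
    Gal(L/K) →* (ZMod n)ˣ :=
  (galEquivZMod n L).toMonoidHom.comp (AlgEquiv.restrictScalarsHom ℚ)

section

variable (n : ℕ) [NeZero n] (K L : Type*) [Field K] [Field L] [NumberField K] [NumberField L]
  [Algebra K L] [IsCyclotomicExtension {n} ℚ L]

/-- The decomposition group over `K` of a prime `Q` of `ℚ(ζₙ)` above `p ∤ n` consists of the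
automorphisms acting on the roots of unity through a power of `p`. -/
theorem stabilizer_eq_comap_zpowers {p : ℕ} (hp : p.Prime) (hpn : p.Coprime n)
    (Q : Ideal (𝓞 L)) [Q.IsPrime] [Q.LiesOver (span {(p : ℤ)})] :
    stabilizer Gal(L/K) Q = (Subgroup.zpowers (ZMod.unitOfCoprime p hpn)).comap
      (relativeCyclotomicCharacter n K L) := by
  have : Fact p.Prime := ⟨hp⟩
  have hp0 : span {(p : ℤ)} ≠ ⊥ := by simpa using hp.ne_zero
  have : Q.IsMaximal := IsPrime.isMaximal inferInstance (ne_bot_of_liesOver_of_ne_bot hp0 Q)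
  rw [← galEquivZMod_stabilizer n L p Q hpn]
  ext σ
  have hσ : (∃ τ ∈ stabilizer Gal(L/ℚ) Q, galEquivZMod n L τ = galEquivZMod n L
      (σ.restrictScalars ℚ)) ↔ σ.restrictScalars ℚ ∈ stabilizer Gal(L/ℚ) Q := by
    simp only [EmbeddingLike.apply_eq_iff_eq, exists_eq_right]
  exact hσ.symm

/-- The inertia degree of `p ∤ n` in a Galois subfield `K` of `ℚ(ζₙ)`, in terms of the class
of `p` modulo `n`. -/
theorem inertiaDegIn_mul_card_comap_zpowers [IsGalois ℚ K] {p : ℕ} (hp : p.Prime)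
    (hpn : p.Coprime n) :
    (span {(p : ℤ)}).inertiaDegIn (𝓞 K) *
        Nat.card ((Subgroup.zpowers (ZMod.unitOfCoprime p hpn)).comap
          (relativeCyclotomicCharacter n K L)) =
      orderOf (ZMod.unitOfCoprime p hpn) := by
  have : Fact p.Prime := ⟨hp⟩
  have hpn' : ¬ p ∣ n := hp.coprime_iff_not_dvd.mp hpn
  have : IsGalois ℚ L := IsCyclotomicExtension.isGalois {n} ℚ L
  have : IsGalois K L := .tower_top_of_isGalois ℚ K L
  have : (span {(p : ℤ)}).IsPrime :=
    (span_singleton_prime (by simpa using hp.ne_zero)).mpr (Nat.prime_iff_prime_int.mp hp)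
  obtain ⟨⟨P, _, _⟩⟩ := (inferInstance : Nonempty (primesOver (span {(p : ℤ)}) (𝓞 K)))
  obtain ⟨⟨Q, _, _⟩⟩ := (inferInstance : Nonempty (primesOver P (𝓞 L)))
  have : Q.LiesOver (span {(p : ℤ)}) := .trans Q P _
  have hp0 : span {(p : ℤ)} ≠ ⊥ := by simpa using hp.ne_zero
  have : P.IsMaximal := IsPrime.isMaximal inferInstance (ne_bot_of_liesOver_of_ne_bot hp0 P)
  have : Finite (𝓞 K ⧸ P) := Ring.HasFiniteQuotients.finiteQuotient
    (ne_bot_of_liesOver_of_ne_bot hp0 P)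
  have : Finite P.ResidueField := .of_surjective _ P.bijective_algebraMap_quotient_residueField.2
  have he := ramificationIdxIn_mul_ramificationIdxIn (p := span {(p : ℤ)}) P Gal(K/ℚ) (𝓞 L)
    Gal(L/ℚ) Gal(L/K)
  have hf := inertiaDegIn_mul_inertiaDegIn (span {(p : ℤ)}) P Gal(K/ℚ) (𝓞 L) Gal(L/ℚ) Gal(L/K)
  -- `e(Q/p) = 1` forces `e(Q/P) = 1`, so the stabilizer of `Q` in `Gal(L/K)` has order `f(Q/P)`.
  rw [ramificationIdxIn_eq_of_not_dvd p L hpn'] at he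
  rw [← stabilizer_eq_comap_zpowers n K L hp hpn Q, card_stabilizer_eq P,
    Nat.eq_one_of_mul_eq_one_left he, one_mul, hf, inertiaDegIn_eq_of_not_dvd p L hpn',
    ← orderOf_injective _ Units.coeHom_injective, Units.coeHom_apply, ZMod.coe_unitOfCoprime]

end

/-- The inertia degree of `p ∤ n` in a Galois subfield of `ℚ(ζₙ)` depends only on `p` modulo `n`. -/
theorem inertiaDegIn_eq_of_modEq (n : ℕ) [NeZero n] (K L : Type*) [Field K] [Field L]
    [NumberField K] [NumberField L] [Algebra K L] [IsCyclotomicExtension {n} ℚ L]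
    [IsGalois ℚ K] {p q : ℕ} (hp : p.Prime) (hq : q.Prime)
    (hpn : p.Coprime n) (hqn : q.Coprime n) (hpq : p ≡ q [MOD n]) :
    (span {(p : ℤ)}).inertiaDegIn (𝓞 K) = (span {(q : ℤ)}).inertiaDegIn (𝓞 K) := by
  have hu : ZMod.unitOfCoprime p hpn = ZMod.unitOfCoprime q hqn :=
    Units.ext (by simpa using (ZMod.natCast_eq_natCast_iff _ _ _).mpr hpq)
  have h₁ := inertiaDegIn_mul_card_comap_zpowers n K L hp hpn
  have h₂ := inertiaDegIn_mul_card_comap_zpowers n K L hq hqn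
  rw [hu, ← h₂] at h₁
  exact Nat.eq_of_mul_eq_mul_right Nat.card_pos h₁

/-- An unramified prime `p` has `[K : ℚ] / f` primes above it, each of ramification index `1` and
inertia degree `f`. -/
theorem decompositionType_eq_replicate (K : Type*) [Field K] [NumberField K] [IsGalois ℚ K]
    {p : ℕ} (hp : p.Prime) (hpK : Algebra.IsUnramifiedIn (𝓞 K) (span {(p : ℤ)})) :
    decompositionType K p = Multiset.replicate
      (Nat.card Gal(K/ℚ) / (span {(p : ℤ)}).inertiaDegIn (𝓞 K))
      (1, (span {(p : ℤ)}).inertiaDegIn (𝓞 K)) := by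
  have : (span {(p : ℤ)}).IsPrime :=
    (span_singleton_prime (by simpa using hp.ne_zero)).mpr (Nat.prime_iff_prime_int.mp hp)
  have hp0 : span {(p : ℤ)} ≠ ⊥ := by simpa using hp.ne_zero
  have : (span {(p : ℤ)}).IsMaximal := IsPrime.isMaximal inferInstance hp0
  have he : (span {(p : ℤ)}).ramificationIdxIn (𝓞 K) = 1 := by
    obtain ⟨⟨P, _, hP⟩⟩ := (inferInstance : Nonempty (primesOver (span {(p : ℤ)}) (𝓞 K)))
    rw [ramificationIdxIn_eq_ramificationIdx _ P Gal(K/ℚ), hpK.ramificationIdx_eq_one hP]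
  have hg := ncard_primesOver_mul_ramificationIdxIn_mul_inertiaDegIn (span {(p : ℤ)}) (𝓞 K)
    Gal(K/ℚ)
  rw [he, one_mul, ← IsDedekindDomain.coe_primesOverFinset hp0, Set.ncard_coe_finset] at hg
  refine Multiset.eq_replicate.mpr ⟨?_, fun x hx ↦ ?_⟩
  · rw [decompositionType, Multiset.card_map, Finset.card_val, ← hg, Nat.mul_div_cancel]
    exact Nat.pos_of_ne_zero (inertiaDegIn_ne_zero Gal(K/ℚ))
  · obtain ⟨P, hP, rfl⟩ := Multiset.mem_map.mp hx
    obtain ⟨_, hP'⟩ := (IsDedekindDomain.mem_primesOverFinset_iff hp0 _).mp hP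
    rw [hpK.ramificationIdx_eq_one hP', inertiaDegIn_eq_inertiaDeg _ P Gal(K/ℚ)]

theorem mainTheorem6 (K : Type*) [Field K] [NumberField K] [NumberField.IsCMField K]
    [IsGalois ℚ K] [IsCyclic Gal(K/ℚ)]
    (f : ℕ) (hf : IsLeast (cyclotomicLevels K) f)
    (p q : ℕ) (hp : p.Prime) (hq : q.Prime)
    (hpK : Algebra.IsUnramifiedIn (𝓞 K) (Ideal.span {(p : ℤ)}))
    (hqK : Algebra.IsUnramifiedIn (𝓞 K) (Ideal.span {(q : ℤ)}))
    (hpq : p ≡ q [MOD f]) :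
    decompositionType K p = decompositionType K q := by
  obtain ⟨hf0, ⟨φ⟩⟩ := hf.1
  have : NeZero f := ⟨hf0.ne'⟩
  -- A prime dividing `f` is alone in its class: `p ∣ f` and `p ≡ q` mod `f` give `p ∣ q`, so `p =
  -- q`.
  by_cases hpf : p ∣ f
  · rw [(Nat.prime_dvd_prime_iff_eq hp hq).mp ((hpq.dvd_iff hpf).mp dvd_rfl)]
  by_cases hqf : q ∣ f
  · rw [(Nat.prime_dvd_prime_iff_eq hq hp).mp ((hpq.dvd_iff hqf).mpr dvd_rfl)]
  let _ : Algebra K (CyclotomicField f ℚ) := φ.toRingHom.toAlgebra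
  -- Transfers the instance to the `ℚ`-algebra structure used by the lemmas above.
  have : @IsCyclotomicExtension {f} ℚ (CyclotomicField f ℚ) _ _ DivisionRing.toRatAlgebra := by
    convert! CyclotomicField.isCyclotomicExtension f ℚ
  rw [decompositionType_eq_replicate K hp hpK, decompositionType_eq_replicate K hq hqK,
    inertiaDegIn_eq_of_modEq f K (CyclotomicField f ℚ) hp hq
      (hp.coprime_iff_not_dvd.mpr hpf) (hq.coprime_iff_not_dvd.mpr hqf) hpq]
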